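/- Let $\mathbb{D}=\{z\in\mathbb{C}:|z|<1\}$ and $\partial\mathbb{D}=\{w\in\mathbb{C}:|w|=1\}$, the latter equipped with arc-length (Lebesgue) measure; "measurable" and "almost every" refer to Lebesgue measurable sets and to this measure. For $R\subset\mathbb{D}$, $w\in\partial\mathbb{D}$ and $r>0$ put $R_w(r)=\{z\in R:|z-w|<r\}$. The set $R$ is an *approach region ending at* $w$ if $w$ belongs to the closure of $R$. An approach region $R$ ending at $w$ - *ends tangentially at $w$* if $\displaystyle \inf_{r>0}\ \sup_{z\in R_w(r)}\frac{1-|z|}{|z-w|}=0$; - is *projectively adjacent to $w$* if there exists $b\in\mathbb{N}$ such that for every $r>0$ there is an open arc $J\subset\partial\mathbb{D}$, of the form $J=\{ve^{i\alpha}:0<\alpha<\theta\}$ with $|v|=1$, $0<\theta\le 2\pi$ and $w\in\{v,ve^{i\theta}\}$ (so $w$ is an endpoint of $J$), such that for every $u\in J$ there is $z\in R_w(r)$ with $|u-z|<(1+b)(1-|z|)$. For $f:\mathbb{D}\to\mathbb{C}$ and $\ell\in\mathbb{C}$, say that $\ell$ is the *limiting value of $f$ along $R$ at $w$* if $\bigcap_{r>0}\overline{f(R_w(r))}=\{\ell\}$,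 the closures being taken in the Riemann sphere $\mathbb{C}\cup\{\infty\}$. **Theorem.** Let $\lambda$ assign to each $w\in\partial\mathbb{D}$ a subset $\lambda(w)$ of $\mathbb{D}$. Suppose that, for every $w\in\partial\mathbb{D}$, $\lambda(w)$ is an approach region ending at $w$ that ends tangentially at $w$ and is projectively adjacent to $w$. Suppose also that $\lambda$ is *regular*: for every open $U\subset\mathbb{D}$ the set $\{w\in\partial\mathbb{D}:U\cap\lambda(w)\neq\emptyset\}$ is measurable. Then there exists a bounded holomorphic function $h$ on $\mathbb{D}$ such that, for almost every $w\in\partial\mathbb{D}$, the limiting value of $h$ along $\lambda(w)$ at $w$ does not exist. -/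

import Mathlib

open Set Metric MeasureTheory

noncomputable section

/-- The open unit disc in `ℂ`. -/
def unitDisc : Set ℂ := ball (0 : ℂ) 1

/-- The unit circle carries its Borel `σ`-algebra. -/
instance instMeasurableSpaceCircle : MeasurableSpace Circle := borel Circle

instance instBorelSpaceCircle : BorelSpace Circle := ⟨rfl⟩

/-- Arc-length measure on the unit circle (of total mass `2π`): the image of one-dimensional
Lebesgue measure on `(-π, π]` under `α ↦ e^{iα}`. -/
def arcLength : Measure Circle :=
  (volume.restrict (Ioc (-Real.pi) Real.pi)).map Circle.exp

/-- The part of `R` that lies in the open ball of centre `w` and radius `r`. -/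
def tailAt (R : Set ℂ) (w : Circle) (r : ℝ) : Set ℂ := R ∩ ball (w : ℂ) r

/-- `R` is an approach region in the unit disc ending at the boundary point `w`. -/
def IsApproachRegion (w : Circle) (R : Set ℂ) : Prop :=
  R ⊆ unitDisc ∧ (w : ℂ) ∈ closure R

/-- `R` is an approach region that ends tangentially at `w`. The supremum and the infimum are
taken in the extended reals, so that the supremum over the empty set is `-∞`. -/
def EndsTangentially (w : Circle) (R : Set ℂ) : Prop :=
  IsApproachRegion w R ∧
    (0 : EReal) =
      ⨅ (r : ℝ) (_ : 0 < r), ⨆ z ∈ tailAt R w r, (((1 - ‖z‖) / ‖z - (w : ℂ)‖ : ℝ) : EReal)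

/-- The open arc that starts at `v` and runs counterclockwise through the angle `θ`. -/
def openArc (v : Circle) (θ : ℝ) : Set Circle :=
  {u | ∃ α : ℝ, 0 < α ∧ α < θ ∧ u = v * Circle.exp α}

/-- `J` is an open arc of the unit circle, of length at most `2π`, that has `w` as one of its
endpoints. -/
def IsArcWithEndpoint (w : Circle) (J : Set Circle) : Prop :=
  ∃ (v : Circle) (θ : ℝ), 0 < θ ∧ θ ≤ 2 * Real.pi ∧ J = openArc v θ ∧
    (w = v ∨ w = v * Circle.exp θ)

/-- `R` is an approach region that is projectively adjacent to `w`. -/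
def ProjectivelyAdjacent (w : Circle) (R : Set ℂ) : Prop :=
  IsApproachRegion w R ∧
    ∃ b : ℕ, ∀ r : ℝ, 0 < r → ∃ J : Set Circle, IsArcWithEndpoint w J ∧
      ∀ u ∈ J, ∃ z ∈ tailAt R w r, ‖(u : ℂ) - z‖ < (1 + (b : ℝ)) * (1 - ‖z‖)

/-- The family `lam` of approach regions is regular: the shadow of each open subset of the disc
is Lebesgue measurable. -/
def IsRegularFamily (lam : Circle → Set ℂ) : Prop :=
  ∀ U : Set ℂ, U ⊆ unitDisc → IsOpen U →
    NullMeasurableSet {w : Circle | (U ∩ lam w).Nonempty} arcLength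

/-- `h`, restricted to the unit disc, is a bounded holomorphic function there. -/
def IsBoundedHolomorphic (h : ℂ → ℂ) : Prop :=
  DifferentiableOn ℂ h unitDisc ∧ ∃ M : ℝ, ∀ z ∈ unitDisc, ‖h z‖ ≤ M

/-- `l` is the limiting value of `f` along `R` at `w`: the cluster set of `f` along `R` at `w`,
formed in the Riemann sphere `ℂ ∪ {∞}`, is `{l}`. -/
def IsLimitingValue (f : ℂ → ℂ) (R : Set ℂ) (w : Circle) (l : ℂ) : Prop :=
  (⋂ (r : ℝ) (_ : 0 < r), closure ((fun z => (f z : OnePoint ℂ)) '' tailAt R w r)) =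
    {(l : OnePoint ℂ)}

end

/-! Take `h = 1 / (1 + S)` with `S = ∑ 4⁻ⁿ / (1 + 8⁻ⁿ - z ^ N n)`. All terms have nonnegative real
part, so `‖h‖ ≤ 1`. Two opposite behaviours along `lam w` exclude a limit.

Small values: within `8⁻ⁿ / N n` of an `N n`-th root of unity, `Re S ≥ 2ⁿ / 4`. Adjacency puts a
point of `lam w` in a cone over a root next to `w`; tangentiality makes that cone low, so the point
is very close to the root (`exists_near_rootOfUnity`). This holds for all large `N`, so regularity
and continuity of measure give `N n` missing only a set of measure at most `2⁻ⁿ`. By Borel–Cantelli,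
almost every `w` is hit for all large `n`.

Large values: almost every `u` satisfies `‖1 - u ^ N n‖ ≥ 2⁻ⁿ` for all `n ≥ k`, some `k`, and then
`S` is bounded on cones over `u` in terms of `k` and the aperture (`norm_peakSum_le_of_mem_cone`).
Almost every `w` is a two-sided limit of such `u` with one fixed `k` (`ae_arc_inter_nonempty`), and
adjacency supplies points of `lam w` near `w` in their cones. -/

open Filter Topology

/-! ### Points of the circle -/

theorem norm_coe_circleExp_sub_le (s t : ℝ) :
    ‖(Circle.exp s : ℂ) - Circle.exp t‖ ≤ |s - t| := by
  have h : (Circle.exp s : ℂ) - Circle.exp t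
      = Circle.exp t * (Complex.exp (Complex.I * ((s - t : ℝ) : ℂ)) - 1) := by
    rw [mul_sub, mul_one]
    congr 1
    rw [Circle.coe_exp, Circle.coe_exp, ← Complex.exp_add]
    congr 1
    push_cast
    ring
  rw [h, norm_mul, Circle.norm_coe, one_mul]
  exact Real.norm_exp_I_mul_ofReal_sub_one_le

theorem exists_int_abs_sub_le_of_norm_one_sub_circleExp (s : ℝ) :
    ∃ k : ℤ, |s - 2 * Real.pi * k| ≤ 2 * ‖(1 : ℂ) - Circle.exp s‖ := by
  have hpi := Real.pi_pos
  refine ⟨round (s / (2 * Real.pi)), ?_⟩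
  set k := round (s / (2 * Real.pi))
  set x := s - 2 * Real.pi * k with hx
  have hx1 : |x| ≤ Real.pi := by
    have h := abs_sub_round (s / (2 * Real.pi))
    have : x = 2 * Real.pi * (s / (2 * Real.pi) - k) := by
      rw [hx]; field_simp
    rw [this, abs_mul, abs_of_pos (by positivity : (0 : ℝ) < 2 * Real.pi)]
    nlinarith
  have he : Circle.exp s = Circle.exp x := by
    rw [Circle.exp_eq_exp]
    exact ⟨k, by rw [hx]; ring⟩
  have hn : ‖(1 : ℂ) - Circle.exp x‖ = 2 * |Real.sin (x / 2)| := by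
    rw [norm_sub_rev, Circle.coe_exp, mul_comm, Complex.norm_exp_I_mul_ofReal_sub_one, norm_mul]
    simp
  have hs := Real.mul_abs_le_abs_sin (x := x / 2) (by rw [abs_div, abs_two]; linarith)
  rw [he, hn]
  rw [abs_div, abs_two] at hs
  -- Jordan's inequality has slope `2 / π`; `π ≤ 4` turns it into the constant `2`.
  have h4 : (1 / 2 : ℝ) ≤ 2 / Real.pi := by
    rw [div_le_div_iff₀ (by norm_num) hpi]; linarith [Real.pi_le_four]
  nlinarith [abs_nonneg x]

/-- An arc with endpoint `w` contains all points close to `w` on one side of `w`. -/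
theorem IsArcWithEndpoint.exists_oneSided {w : Circle} {J : Set Circle}
    (h : IsArcWithEndpoint w J) :
    ∃ θ : ℝ, 0 < θ ∧ ((∀ α, 0 < α → α < θ → w * Circle.exp α ∈ J) ∨
      ∀ α, 0 < α → α < θ → w * Circle.exp (-α) ∈ J) := by
  obtain ⟨v, θ, hθ, -, rfl, rfl | rfl⟩ := h
  · exact ⟨θ, hθ, Or.inl fun α h0 h1 => ⟨α, h0, h1, rfl⟩⟩
  · refine ⟨θ, hθ, Or.inr fun α h0 h1 => ⟨θ - α, by linarith, by linarith, ?_⟩⟩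
    rw [mul_assoc, ← Circle.exp_add, sub_eq_add_neg]

theorem EndsTangentially.exists_height_lt {w : Circle} {R : Set ℂ} (h : EndsTangentially w R)
    {ε : ℝ} (hε : 0 < ε) :
    ∃ r : ℝ, 0 < r ∧ ∀ z ∈ tailAt R w r, 1 - ‖z‖ < ε * ‖z - w‖ := by
  obtain ⟨⟨hR, -⟩, h0⟩ := h
  have h1 : (⨅ (r : ℝ) (_ : 0 < r), ⨆ z ∈ tailAt R w r,
      (((1 - ‖z‖) / ‖z - (w : ℂ)‖ : ℝ) : EReal)) < (ε : EReal) := by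
    rw [← h0]; exact_mod_cast hε
  simp only [iInf_lt_iff] at h1
  obtain ⟨r, hr, h2⟩ := h1
  refine ⟨r, hr, fun z hz => ?_⟩
  have h3 : (((1 - ‖z‖) / ‖z - (w : ℂ)‖ : ℝ) : EReal) < (ε : EReal) :=
    lt_of_le_of_lt
      (le_iSup₂ (f := fun z (_ : z ∈ tailAt R w r) =>
        (((1 - ‖z‖) / ‖z - (w : ℂ)‖ : ℝ) : EReal)) z hz) h2
  rw [EReal.coe_lt_coe_iff] at h3
  have hz1 : ‖z‖ < 1 := by simpa [unitDisc] using hR hz.1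
  have hne : z - (w : ℂ) ≠ 0 := by
    intro h
    rw [sub_eq_zero.1 h, Circle.norm_coe] at hz1
    exact lt_irrefl _ hz1
  exact (div_lt_iff₀ (norm_pos_iff.2 hne)).1 h3

/-- A tangential and projectively adjacent region comes, at every small scale `1 / N`, much closer
than `1 / N` to an `N`-th root of unity. -/
theorem exists_near_rootOfUnity {w : Circle} {R : Set ℂ} (ht : EndsTangentially w R)
    (hp : ProjectivelyAdjacent w R) {ρ : ℝ} (hρ : 0 < ρ) :
    ∀ᶠ N : ℕ in atTop, ∃ k : ℤ, ‖(w : ℂ) - Circle.exp (2 * Real.pi * k / N)‖ < 20 / N ∧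
      (ball (Circle.exp (2 * Real.pi * k / N) : ℂ) (ρ / N) ∩ unitDisc ∩ R).Nonempty := by
  obtain ⟨hR, b, hb⟩ := hp
  have hpi := Real.pi_pos
  have hpi4 := Real.pi_le_four
  have hb0 : (0 : ℝ) < 1 + b := by positivity
  -- The first bound absorbs `‖u - z‖` in the triangle inequality, giving `‖z - w‖ ≤ 16 / N`; the
  -- second turns `16 / N` into `ρ / N`.
  obtain ⟨ε, hε, hε1, hε2⟩ : ∃ ε : ℝ, 0 < ε ∧ (1 + b) * ε ≤ 1 / 2 ∧ (1 + b) * ε * 16 ≤ ρ := by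
    refine ⟨min (1 / 2) (ρ / 16) / (1 + b), by positivity, ?_, ?_⟩
    · rw [mul_div_cancel₀ _ hb0.ne']; exact min_le_left _ _
    · rw [mul_div_cancel₀ _ hb0.ne']; linarith [min_le_right (1 / 2) (ρ / 16)]
  obtain ⟨r, hr, hrt⟩ := ht.exists_height_lt hε
  obtain ⟨J, hJ, hJz⟩ := hb r hr
  obtain ⟨θ, hθ, hside⟩ := hJ.exists_oneSided
  obtain ⟨t, rfl⟩ : ∃ t, Circle.exp t = w := ⟨_, Circle.exp_arg w⟩
  obtain ⟨N₀, hN₀⟩ := exists_nat_gt (8 / θ)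
  filter_upwards [eventually_ge_atTop (N₀ + 1)] with N hN
  have hNpos : (0 : ℝ) < N := by exact_mod_cast (by omega : 0 < N)
  have hNθ : 8 / N < θ := by
    have h1 : (N₀ : ℝ) < N := by exact_mod_cast (by omega : N₀ < N)
    rw [div_lt_iff₀ hNpos]
    have := (div_lt_iff₀ hθ).1 (hN₀.trans h1)
    linarith
  -- The nearest root strictly on the side of `J`: `⌊x⌋ + 1` or `⌈x⌉ - 1`, strict because `w` is
  -- only an endpoint of `J`.
  obtain ⟨k, hkJ, hkd⟩ : ∃ k : ℤ, Circle.exp (2 * Real.pi * k / N) ∈ J ∧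
      |2 * Real.pi * k / N - t| ≤ 2 * Real.pi / N := by
    have hx : t = 2 * Real.pi * (t * N / (2 * Real.pi)) / N := by field_simp
    set x := t * N / (2 * Real.pi)
    have hc : 0 < 2 * Real.pi / N := by positivity
    have hc8 : 2 * Real.pi / N < θ :=
      lt_of_le_of_lt (by gcongr; linarith) hNθ
    rcases hside with hs | hs
    · have h1 := Int.lt_floor_add_one x
      have h2 := Int.floor_le x
      have e : 2 * Real.pi * ((⌊x⌋ + 1 : ℤ) : ℝ) / N - t
          = 2 * Real.pi / N * (⌊x⌋ + 1 - x) := by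
        conv_lhs => rw [hx]
        push_cast; ring
      have e0 : 0 < 2 * Real.pi * ((⌊x⌋ + 1 : ℤ) : ℝ) / N - t := by
        rw [e]; exact mul_pos hc (by linarith)
      have e1 : 2 * Real.pi * ((⌊x⌋ + 1 : ℤ) : ℝ) / N - t ≤ 2 * Real.pi / N := by
        rw [e]; exact mul_le_of_le_one_right hc.le (by linarith)
      refine ⟨⌊x⌋ + 1, ?_, by rwa [abs_of_pos e0]⟩
      have := hs _ e0 (e1.trans_lt hc8)
      rwa [← Circle.exp_add, add_sub_cancel] at this
    · have h1 := Int.ceil_lt_add_one x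
      have h2 := Int.le_ceil x
      have e : t - 2 * Real.pi * ((⌈x⌉ - 1 : ℤ) : ℝ) / N
          = 2 * Real.pi / N * (x - (⌈x⌉ - 1)) := by
        conv_lhs => rw [hx]
        push_cast; ring
      have e0 : 0 < t - 2 * Real.pi * ((⌈x⌉ - 1 : ℤ) : ℝ) / N := by
        rw [e]; exact mul_pos hc (by linarith)
      have e1 : t - 2 * Real.pi * ((⌈x⌉ - 1 : ℤ) : ℝ) / N ≤ 2 * Real.pi / N := by
        rw [e]; exact mul_le_of_le_one_right hc.le (by linarith)
      refine ⟨⌈x⌉ - 1, ?_, by rwa [abs_sub_comm, abs_of_pos e0]⟩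
      have := hs _ e0 (e1.trans_lt hc8)
      rwa [← Circle.exp_add, neg_sub, add_sub_cancel] at this
  obtain ⟨z, hz, hzu⟩ := hJz _ hkJ
  have hzt := hrt z hz
  set u : ℂ := (Circle.exp (2 * Real.pi * k / N) : ℂ)
  set w : ℂ := (Circle.exp t : ℂ)
  have huw : ‖u - w‖ ≤ 8 / N :=
    (norm_coe_circleExp_sub_le _ _).trans (hkd.trans (by gcongr; linarith))
  have huz : ‖u - z‖ ≤ (1 + b) * ε * ‖z - w‖ := by
    nlinarith [mul_lt_mul_of_pos_left hzt hb0]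
  have htri : ‖z - w‖ ≤ ‖u - z‖ + ‖u - w‖ := by
    rw [norm_sub_rev u z]
    simpa using norm_add_le (z - u) (u - w)
  have hzw : ‖z - w‖ ≤ 16 / N := by
    have h2 : (16 : ℝ) / N = 2 * (8 / N) := by ring
    nlinarith [norm_nonneg (z - w)]
  refine ⟨k, ?_, z, ⟨?_, hR.1 hz.1⟩, hz.1⟩
  · rw [norm_sub_rev]
    exact huw.trans_lt (by gcongr; norm_num)
  · rw [mem_ball, dist_eq_norm, norm_sub_rev]
    calc ‖u - z‖ < (1 + b) * (1 - ‖z‖) := hzu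
      _ ≤ (1 + b) * (ε * ‖z - w‖) := by gcongr
      _ ≤ (1 + b) * (ε * (16 / N)) := by gcongr
      _ = (1 + b) * ε * 16 / N := by ring
      _ ≤ ρ / N := by gcongr

/-! ### Arc length -/

instance : IsFiniteMeasure arcLength := by
  unfold arcLength; infer_instance

theorem measurable_circleExp : Measurable Circle.exp := Circle.exp.continuous.measurable

theorem arcLength_eq_zero_of_countable {s : Set Circle} (hs : s.Countable) :
    arcLength s = 0 := by
  rw [arcLength, Measure.map_apply measurable_circleExp hs.measurableSet,
    Measure.restrict_apply (measurable_circleExp hs.measurableSet)]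
  refine Set.Countable.measure_zero ?_ _
  have hinj : InjOn Circle.exp (Circle.exp ⁻¹' s ∩ Ioc (-Real.pi) Real.pi) :=
    (Circle.exp_injOn_Ioc (by linarith)).mono inter_subset_right
  refine Set.countable_of_injective_of_countable_image hinj (hs.mono ?_)
  rintro _ ⟨x, hx, rfl⟩
  exact hx.1

/-- The angles lie within `2ε / N` of some `2πk / N` with `|k| ≤ N`: at most `2N + 1` intervals of
length `4ε / N`. -/
theorem arcLength_setOf_norm_one_sub_pow_lt {N : ℕ} (hN : 0 < N) {ε : ℝ} (hε : 0 < ε)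
    (hε1 : ε ≤ 1) :
    arcLength {u : Circle | ‖(1 : ℂ) - (u : ℂ) ^ N‖ < ε} ≤ ENNReal.ofReal (12 * ε) := by
  have hpi := Real.pi_pos
  have hNpos : (0 : ℝ) < N := by exact_mod_cast hN
  have hN1 : (1 : ℝ) ≤ N := by exact_mod_cast hN
  have hm : MeasurableSet {u : Circle | ‖(1 : ℂ) - (u : ℂ) ^ N‖ < ε} :=
    (isOpen_lt (by fun_prop) continuous_const).measurableSet
  rw [arcLength, Measure.map_apply measurable_circleExp hm,
    Measure.restrict_apply (measurable_circleExp hm)]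
  have hsub : Circle.exp ⁻¹' {u : Circle | ‖(1 : ℂ) - (u : ℂ) ^ N‖ < ε} ∩ Ioc (-Real.pi) Real.pi ⊆
      ⋃ k ∈ Finset.Icc (-(N : ℤ)) N, closedBall (2 * Real.pi * k / N) (2 * ε / N) := by
    rintro t ⟨ht, ht1, ht2⟩
    have ht' : ‖(1 : ℂ) - Circle.exp (N * t)‖ < ε := by
      have : (Circle.exp (N * t) : ℂ) = (Circle.exp t : ℂ) ^ N := by
        rw [Circle.coe_exp, Circle.coe_exp, ← Complex.exp_nat_mul]
        push_cast; ring_nf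
      rw [this]; exact ht
    obtain ⟨k, hk⟩ := exists_int_abs_sub_le_of_norm_one_sub_circleExp (N * t)
    have hk' : |N * t - 2 * Real.pi * k| ≤ 2 * ε := by linarith
    obtain ⟨hk1, hk2⟩ := abs_le.1 hk'
    have hpi3 := Real.pi_gt_three
    have hu : (k : ℝ) < N + 1 := by
      by_contra! hc
      nlinarith
    have hl : (-(N : ℝ) - 1) < k := by
      by_contra! hc
      nlinarith
    have hu' : k < N + 1 := by exact_mod_cast hu
    have hl' : -(N : ℤ) - 1 < k := by exact_mod_cast hl
    simp only [mem_iUnion, Finset.mem_Icc]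
    refine ⟨k, ⟨by omega, by omega⟩, ?_⟩
    rw [mem_closedBall, Real.dist_eq, le_div_iff₀ hNpos]
    calc |t - 2 * Real.pi * k / N| * N = |(t - 2 * Real.pi * k / N) * N| := by
          rw [abs_mul, abs_of_pos hNpos]
      _ = |N * t - 2 * Real.pi * k| := by congr 1; field_simp
      _ ≤ 2 * ε := hk'
  refine (measure_mono hsub).trans ((measure_biUnion_finset_le _ _).trans ?_)
  simp only [Real.volume_closedBall, Finset.sum_const, Int.card_Icc, nsmul_eq_mul]
  have hc : ((N : ℤ) + 1 - -(N : ℤ)).toNat = 2 * N + 1 := by omega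
  rw [hc, ← ENNReal.ofReal_natCast, ← ENNReal.ofReal_mul (by positivity)]
  refine ENNReal.ofReal_le_ofReal ?_
  have : ((2 * N + 1 : ℕ) : ℝ) * (2 * (2 * ε / N)) = 8 * ε + 4 * ε / N := by
    push_cast; field_simp; ring
  rw [this]
  have : 4 * ε / N ≤ 4 * ε := div_le_self (by positivity) hN1
  linarith

/-- Almost every point of a set is a limit of the set from both sides. -/
theorem ae_arc_inter_nonempty (F : Set Circle) :
    ∀ᵐ w ∂arcLength, w ∈ F → ∀ J, IsArcWithEndpoint w J → (F ∩ J).Nonempty := by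
  set E := Circle.exp ⁻¹' F
  -- A subset of the line has only countably many points isolated from one side.
  have hc : (Circle.exp '' ({x ∈ E | 𝓝[E ∩ Ioi x] x = ⊥} ∪ {x ∈ E | 𝓝[E ∩ Iio x] x = ⊥})).Countable :=
    (countable_setOfPred_isolated_right_within.union
      countable_setOfPred_isolated_left_within).image _
  have h0 := arcLength_eq_zero_of_countable hc
  filter_upwards [measure_eq_zero_iff_ae_notMem.1 h0] with w hw hwF J hJ
  obtain ⟨t, rfl⟩ : ∃ t, Circle.exp t = w := ⟨_, Circle.exp_arg w⟩
  have hr : (𝓝[E ∩ Ioi t] t).NeBot := ⟨fun h => hw ⟨t, Or.inl ⟨hwF, h⟩, rfl⟩⟩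
  have hl : (𝓝[E ∩ Iio t] t).NeBot := ⟨fun h => hw ⟨t, Or.inr ⟨hwF, h⟩, rfl⟩⟩
  obtain ⟨θ, hθ, hs | hs⟩ := hJ.exists_oneSided
  · obtain ⟨x, ⟨hxE, hxt⟩, hx⟩ := (Filter.inter_mem self_mem_nhdsWithin
      (mem_nhdsWithin_of_mem_nhds (Iio_mem_nhds (show t < t + θ by linarith)))
      : (E ∩ Ioi t) ∩ Iio (t + θ) ∈ 𝓝[E ∩ Ioi t] t) |> hr.nonempty_of_mem
    simp only [mem_Ioi, mem_Iio] at hxt hx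
    have := hs (x - t) (by linarith) (by linarith)
    rw [← Circle.exp_add, add_sub_cancel] at this
    exact ⟨_, hxE, this⟩
  · obtain ⟨x, ⟨hxE, hxt⟩, hx⟩ := (Filter.inter_mem self_mem_nhdsWithin
      (mem_nhdsWithin_of_mem_nhds (Ioi_mem_nhds (show t - θ < t by linarith)))
      : (E ∩ Iio t) ∩ Ioi (t - θ) ∈ 𝓝[E ∩ Iio t] t) |> hl.nonempty_of_mem
    simp only [mem_Ioi, mem_Iio] at hxt hx
    have := hs (t - x) (by linarith) (by linarith)
    rw [← Circle.exp_add, neg_sub, add_sub_cancel] at this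
    exact ⟨_, hxE, this⟩

/-! ### Lacunary series of peak functions -/

theorem norm_pow_sub_pow_le_mul {u z : ℂ} (hu : ‖u‖ ≤ 1) (hz : ‖z‖ ≤ 1) (N : ℕ) :
    ‖u ^ N - z ^ N‖ ≤ N * ‖u - z‖ := by
  induction N with
  | zero => simp
  | succ n ih =>
    have e : u ^ (n + 1) - z ^ (n + 1) = u ^ n * (u - z) + (u ^ n - z ^ n) * z := by ring
    rw [e]
    refine (norm_add_le _ _).trans ?_
    rw [norm_mul, norm_mul, norm_pow]
    have h1 : ‖u‖ ^ n * ‖u - z‖ ≤ ‖u - z‖ :=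
      mul_le_of_le_one_left (norm_nonneg _) (pow_le_one₀ (norm_nonneg _) hu)
    have h2 : ‖u ^ n - z ^ n‖ * ‖z‖ ≤ ‖u ^ n - z ^ n‖ :=
      mul_le_of_le_one_right (norm_nonneg _) hz
    push_cast
    linarith

/-- In a Stolz cone over `u`, the distance of `z ^ N` to `1` is not much smaller than that
of `u ^ N`. -/
theorem norm_one_sub_pow_le_of_mem_cone {u z : ℂ} {b : ℝ} (hb : 0 ≤ b) (hu : ‖u‖ = 1)
    (hz : ‖z‖ < 1) (hc : ‖u - z‖ ≤ (1 + b) * (1 - ‖z‖)) (N : ℕ) :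
    ‖1 - u ^ N‖ ≤ (4 + 2 * b) * ‖1 - z ^ N‖ := by
  set t := 1 - ‖z‖ with ht
  have ht0 : 0 < t := by linarith
  have ht1 : t ≤ 1 := by linarith [norm_nonneg z]
  have hNt : 0 ≤ N * t := by positivity
  -- By Bernoulli, `1 - (1 - t) ^ N ≥ Nt / (1 + Nt)`, which is at least `Nt / 2` or `1 / 2`
  -- according as `Nt ≤ 1` or `Nt ≥ 1`.
  have h1 : (1 - t) ^ N * (1 + N * t) ≤ 1 := by
    calc (1 - t) ^ N * (1 + N * t) ≤ (1 - t) ^ N * (1 + t) ^ N := by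
          have := one_add_mul_le_pow (a := t) (by linarith) N
          exact mul_le_mul_of_nonneg_left this (pow_nonneg (by linarith) N)
      _ = (1 - t ^ 2) ^ N := by rw [← mul_pow]; ring
      _ ≤ 1 := pow_le_one₀ (by nlinarith) (by nlinarith)
  have h2 : 1 - (1 - t) ^ N ≤ ‖1 - z ^ N‖ := by
    have := norm_sub_norm_le (1 : ℂ) (z ^ N)
    rw [norm_one, norm_pow] at this
    have e : 1 - t = ‖z‖ := by rw [ht]; ring
    rwa [e]
  have hp : 0 ≤ (1 - t) ^ N := pow_nonneg (by linarith) N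
  have hD := norm_nonneg (1 - z ^ N)
  rcases le_total (N * t) 1 with h | h
  · have h3 : N * t / 2 ≤ ‖1 - z ^ N‖ := by nlinarith
    have h4 := norm_pow_sub_pow_le_mul hu.le hz.le N
    have h5 : ‖1 - u ^ N‖ ≤ ‖1 - z ^ N‖ + ‖u ^ N - z ^ N‖ := by
      have e : 1 - u ^ N = (1 - z ^ N) - (u ^ N - z ^ N) := by ring
      rw [e]; exact norm_sub_le _ _
    have h6 : (N : ℝ) * ‖u - z‖ ≤ N * ((1 + b) * t) := by gcongr
    nlinarith
  · have h3 : 1 / 2 ≤ ‖1 - z ^ N‖ := by nlinarith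
    have h4 : ‖1 - u ^ N‖ ≤ 2 := by
      refine (norm_sub_le _ _).trans ?_
      rw [norm_one, norm_pow, hu, one_pow]; norm_num
    nlinarith

/-- The `n`-th term of the series; it is large near the `N n`-th roots of unity. -/
noncomputable def peakTerm (N : ℕ → ℕ) (n : ℕ) (z : ℂ) : ℂ :=
  (((1 / 4 : ℝ) ^ n : ℝ) : ℂ) / (1 + (((1 / 8 : ℝ) ^ n : ℝ) : ℂ) - z ^ N n)

/-- Weight `4⁻ⁿ` over width `8⁻ⁿ` gives unbounded peaks `2ⁿ`; over distance `2⁻ⁿ` from `1` it gives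
a summable `2⁻ⁿ`. -/
noncomputable def peakSum (N : ℕ → ℕ) (z : ℂ) : ℂ := ∑' n, peakTerm N n z

section peak

variable {N : ℕ → ℕ} {z : ℂ}

theorem re_pow_le_norm (n : ℕ) (hN : 0 < n) (hz : ‖z‖ < 1) : (z ^ n).re ≤ ‖z‖ := by
  refine (Complex.re_le_norm _).trans ?_
  rw [norm_pow]
  exact pow_le_of_le_one (norm_nonneg _) hz.le hN.ne'

theorem le_re_peakDenom (hN : ∀ n, 0 < N n) (hz : ‖z‖ < 1) (n : ℕ) :
    (1 / 8 : ℝ) ^ n + (1 - ‖z‖) ≤ (1 + (((1 / 8 : ℝ) ^ n : ℝ) : ℂ) - z ^ N n).re := by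
  have := re_pow_le_norm (N n) (hN n) hz
  rw [Complex.sub_re, Complex.add_re, Complex.one_re, Complex.ofReal_re]
  linarith

theorem peakDenom_ne_zero (hN : ∀ n, 0 < N n) (hz : ‖z‖ < 1) (n : ℕ) :
    (1 + (((1 / 8 : ℝ) ^ n : ℝ) : ℂ) - z ^ N n) ≠ 0 := by
  intro h
  have := le_re_peakDenom hN hz n
  rw [h, Complex.zero_re] at this
  have : (0 : ℝ) < (1 / 8) ^ n := by positivity
  linarith

theorem norm_peakTerm_le {c : ℝ} (hc : 0 < c) {n : ℕ}
    (h : c ≤ ‖(1 + (((1 / 8 : ℝ) ^ n : ℝ) : ℂ) - z ^ N n)‖) :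
    ‖peakTerm N n z‖ ≤ (1 / 4) ^ n / c := by
  rw [peakTerm, norm_div, Complex.norm_real, Real.norm_of_nonneg (by positivity)]
  gcongr

theorem norm_peakTerm_le_of_norm_lt (hN : ∀ n, 0 < N n) (hz : ‖z‖ < 1) (n : ℕ) :
    ‖peakTerm N n z‖ ≤ (1 / 4) ^ n / (1 - ‖z‖) := by
  refine norm_peakTerm_le (by linarith) (le_trans ?_ (Complex.re_le_norm _))
  have := le_re_peakDenom hN hz n
  have : (0 : ℝ) < (1 / 8) ^ n := by positivity
  linarith

theorem norm_peakTerm_le_two_pow (hN : ∀ n, 0 < N n) (hz : ‖z‖ < 1) (n : ℕ) :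
    ‖peakTerm N n z‖ ≤ 2 ^ n := by
  have h : (2 : ℝ) ^ n = (1 / 4) ^ n / (1 / 8) ^ n := by rw [← div_pow]; norm_num
  rw [h]
  refine norm_peakTerm_le (by positivity) (le_trans ?_ (Complex.re_le_norm _))
  have := le_re_peakDenom hN hz n
  linarith

theorem norm_peakTerm_le_of_mem_cone (hN : ∀ n, 0 < N n) (hz : ‖z‖ < 1) {u : ℂ} {b : ℝ}
    (hb : 0 ≤ b) (hu : ‖u‖ = 1) (hc : ‖u - z‖ ≤ (1 + b) * (1 - ‖z‖)) {n : ℕ}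
    (hn : (1 / 2) ^ n ≤ ‖1 - u ^ N n‖) :
    ‖peakTerm N n z‖ ≤ (4 + 2 * b) * (1 / 2) ^ n := by
  have h1 := norm_one_sub_pow_le_of_mem_cone hb hu hz hc (N n)
  have hre : (z ^ N n).re ≤ 1 := (re_pow_le_norm (N n) (hN n) hz).trans hz.le
  have hρ : (0 : ℝ) < (1 / 8) ^ n := by positivity
  -- `1 - z ^ N n` has nonnegative real part, so adding a positive number increases its modulus.
  have h2 : ‖1 - z ^ N n‖ ≤ ‖(1 + (((1 / 8 : ℝ) ^ n : ℝ) : ℂ) - z ^ N n)‖ := by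
    rw [Complex.norm_def, Complex.norm_def]
    refine Real.sqrt_le_sqrt ?_
    rw [Complex.normSq_apply, Complex.normSq_apply]
    simp only [Complex.sub_re, Complex.add_re, Complex.one_re, Complex.ofReal_re, Complex.sub_im,
      Complex.add_im, Complex.one_im, Complex.ofReal_im]
    nlinarith
  have h3 : (4 + 2 * b) * (1 / 2) ^ n = (1 / 4) ^ n / ((1 / 2) ^ n / (4 + 2 * b)) := by
    have : (1 / 4 : ℝ) ^ n = (1 / 2) ^ n * (1 / 2) ^ n := by rw [← mul_pow]; norm_num
    rw [this]; field_simp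
  rw [h3]
  refine norm_peakTerm_le (by positivity) (le_trans ?_ h2)
  rw [div_le_iff₀ (by positivity)]
  linarith

theorem summable_peakTerm (hN : ∀ n, 0 < N n) (hz : ‖z‖ < 1) :
    Summable fun n => peakTerm N n z :=
  .of_norm_bounded ((summable_geometric_of_lt_one (by norm_num) (by norm_num)).div_const _)
    (norm_peakTerm_le_of_norm_lt hN hz)

theorem re_peakTerm_nonneg (hN : ∀ n, 0 < N n) (hz : ‖z‖ < 1) (n : ℕ) :
    0 ≤ (peakTerm N n z).re := by
  have h := le_re_peakDenom hN hz n
  have : (0 : ℝ) < (1 / 8) ^ n := by positivity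
  rw [peakTerm, div_eq_mul_inv, Complex.re_ofReal_mul, Complex.inv_re]
  exact mul_nonneg (by positivity) (div_nonneg (by linarith) (Complex.normSq_nonneg _))

/-- Positivity of the real parts prevents other terms from cancelling a peak. -/
theorem re_peakTerm_le_re_peakSum (hN : ∀ n, 0 < N n) (hz : ‖z‖ < 1) (n : ℕ) :
    (peakTerm N n z).re ≤ (peakSum N z).re := by
  rw [peakSum, Complex.re_tsum (summable_peakTerm hN hz)]
  exact (Complex.hasSum_re (summable_peakTerm hN hz).hasSum).summable.le_tsum n
    fun m _ => re_peakTerm_nonneg hN hz m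

theorem re_peakSum_nonneg (hN : ∀ n, 0 < N n) (hz : ‖z‖ < 1) : 0 ≤ (peakSum N z).re :=
  (re_peakTerm_nonneg hN hz 0).trans (re_peakTerm_le_re_peakSum hN hz 0)

/-- With `ρ = 8⁻ⁿ`, the denominator `D` has `Re D ≥ ρ` and `‖D‖ ≤ 2ρ`, so `Re (1 / D) ≥ 1 / (4ρ)`.
-/
theorem le_re_peakTerm (hN : ∀ n, 0 < N n) (hz : ‖z‖ < 1) {ζ : ℂ} {n : ℕ} (hζ : ‖ζ‖ = 1)
    (hζN : ζ ^ N n = 1) (hd : ‖z - ζ‖ ≤ (1 / 8) ^ n / N n) :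
    2 ^ n / 4 ≤ (peakTerm N n z).re := by
  have hNpos : (0 : ℝ) < N n := by exact_mod_cast hN n
  set ρ : ℝ := (1 / 8) ^ n with hρ
  have hρ0 : 0 < ρ := by positivity
  have h1 : ‖z ^ N n - 1‖ ≤ ρ := by
    rw [← hζN]
    refine (norm_pow_sub_pow_le_mul hz.le hζ.le _).trans ?_
    rw [le_div_iff₀ hNpos] at hd
    linarith
  set D := (1 + (ρ : ℂ) - z ^ N n) with hD
  have hre : ρ ≤ D.re := by
    have := le_re_peakDenom hN hz n
    rw [← hρ] at this
    linarith
  have hn : ‖D‖ ≤ 2 * ρ := by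
    have e : D = (ρ : ℂ) - (z ^ N n - 1) := by rw [hD]; ring
    rw [e]
    refine (norm_sub_le _ _).trans ?_
    rw [Complex.norm_real, Real.norm_of_nonneg hρ0.le]
    linarith
  have hsq : Complex.normSq D ≤ 4 * ρ ^ 2 := by
    rw [Complex.normSq_eq_norm_sq]
    nlinarith [norm_nonneg D]
  have hsq0 : 0 < Complex.normSq D := Complex.normSq_pos.2 (peakDenom_ne_zero hN hz n)
  have e : (2 : ℝ) ^ n / 4 = (1 / 4) ^ n * (ρ / (4 * ρ ^ 2)) := by
    have : (2 : ℝ) ^ n = (1 / 4) ^ n / ρ := by rw [hρ, ← div_pow]; norm_num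
    rw [this]; field_simp
  rw [e, peakTerm, div_eq_mul_inv (Complex.ofReal _), Complex.re_ofReal_mul, Complex.inv_re]
  gcongr
  exact hρ0.le.trans hre

theorem norm_peakSum_le_of_mem_cone (hN : ∀ n, 0 < N n) (hz : ‖z‖ < 1) {u : ℂ} {b : ℝ}
    (hb : 0 ≤ b) (hu : ‖u‖ = 1) (hc : ‖u - z‖ ≤ (1 + b) * (1 - ‖z‖)) {k : ℕ}
    (hk : ∀ n, k ≤ n → (1 / 2) ^ n ≤ ‖1 - u ^ N n‖) :
    ‖peakSum N z‖ ≤ (4 ^ k + (4 + 2 * b)) * 2 := by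
  refine tsum_of_norm_bounded (f := fun n => peakTerm N n z)
    (hasSum_geometric_two.mul_left (4 ^ k + (4 + 2 * b))) fun n => ?_
  have h2 : (0 : ℝ) < (1 / 2) ^ n := by positivity
  -- Terms below `k` only obey the crude bound `2ⁿ = 4ⁿ 2⁻ⁿ ≤ 4ᵏ 2⁻ⁿ`; the others obey the cone
  -- bound.
  rcases lt_or_ge n k with h | h
  · have h3 := norm_peakTerm_le_two_pow hN hz n
    have h4 : (2 : ℝ) ^ n = 4 ^ n * (1 / 2) ^ n := by rw [← mul_pow]; norm_num
    have h5 : (4 : ℝ) ^ n ≤ 4 ^ k := pow_le_pow_right₀ (by norm_num) h.le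
    nlinarith
  · have h3 := norm_peakTerm_le_of_mem_cone hN hz hb hu hc (hk n h)
    have h5 : (0 : ℝ) < 4 ^ k := by positivity
    nlinarith

end peak

theorem differentiableOn_peakSum {N : ℕ → ℕ} (hN : ∀ n, 0 < N n) :
    DifferentiableOn ℂ (peakSum N) unitDisc := by
  intro z hz
  have hz1 : ‖z‖ < 1 := by simpa [unitDisc] using hz
  obtain ⟨r, hzr, hr1⟩ := exists_between hz1
  have hlt : ∀ x ∈ ball (0 : ℂ) r, ‖x‖ < r := fun x hx => by simpa using hx
  have h : DifferentiableOn ℂ (peakSum N) (ball 0 r) := by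
    refine Complex.differentiableOn_tsum_of_summable_norm (u := fun n => (1 / 4) ^ n / (1 - r))
      ((summable_geometric_of_lt_one (by norm_num) (by norm_num)).div_const _) (fun n => ?_)
      isOpen_ball (fun n x hx => ?_)
    · unfold peakTerm
      refine DifferentiableOn.div (by fun_prop) (by fun_prop) fun x hx => ?_
      exact peakDenom_ne_zero hN ((hlt x hx).trans hr1) n
    · have hx' := hlt x hx
      refine (norm_peakTerm_le_of_norm_lt hN (hx'.trans hr1) n).trans ?_
      have : 0 < 1 - r := by linarith
      gcongr
  exact (h.differentiableAt (isOpen_ball.mem_nhds (by simpa using hzr))).differentiableWithinAt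

/-- The bounded function whose reciprocal is `1 + peakSum N`. -/
noncomputable def peakInv (N : ℕ → ℕ) (z : ℂ) : ℂ := (1 + peakSum N z)⁻¹

theorem one_le_re_one_add_peakSum {N : ℕ → ℕ} (hN : ∀ n, 0 < N n) {z : ℂ} (hz : ‖z‖ < 1) :
    1 ≤ (1 + peakSum N z).re := by
  have := re_peakSum_nonneg hN hz
  rw [Complex.add_re, Complex.one_re]; linarith

theorem norm_peakInv_le_one {N : ℕ → ℕ} (hN : ∀ n, 0 < N n) {z : ℂ} (hz : ‖z‖ < 1) :
    ‖peakInv N z‖ ≤ 1 := by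
  rw [peakInv, norm_inv]
  exact inv_le_one_of_one_le₀ ((one_le_re_one_add_peakSum hN hz).trans (Complex.re_le_norm _))

theorem isBoundedHolomorphic_peakInv {N : ℕ → ℕ} (hN : ∀ n, 0 < N n) :
    IsBoundedHolomorphic (peakInv N) := by
  have hlt : ∀ z ∈ unitDisc, ‖z‖ < 1 := fun z hz => by simpa [unitDisc] using hz
  refine ⟨?_, 1, fun z hz => norm_peakInv_le_one hN (hlt z hz)⟩
  refine DifferentiableOn.inv ((differentiableOn_peakSum hN).const_add 1) fun z hz h => ?_
  have := one_le_re_one_add_peakSum hN (hlt z hz)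
  rw [h, Complex.zero_re] at this
  linarith

/-! ### Cluster sets -/

/-- A bounded function that is arbitrarily small and repeatedly not small along `R` has no
limiting value along `R`. -/
theorem not_isLimitingValue {f : ℂ → ℂ} {R : Set ℂ} {w : Circle} {M c : ℝ} (hc : 0 < c)
    (hM : ∀ z ∈ R, ‖f z‖ ≤ M)
    (hsmall : ∀ r : ℝ, 0 < r → ∀ ε : ℝ, 0 < ε → ∃ z ∈ tailAt R w r, ‖f z‖ < ε)
    (hlarge : ∀ r : ℝ, 0 < r → ∃ z ∈ tailAt R w r, c ≤ ‖f z‖) :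
    ¬ ∃ l : ℂ, IsLimitingValue f R w l := by
  rintro ⟨l, hl⟩
  have key : ∀ x : ℂ, (∀ r : ℝ, 0 < r → x ∈ closure (f '' tailAt R w r)) → x = l := by
    intro x hx
    have hmem : (x : OnePoint ℂ) ∈ ({(l : OnePoint ℂ)} : Set (OnePoint ℂ)) := by
      rw [← hl]
      refine mem_iInter₂.2 fun r hr => ?_
      have h := image_closure_subset_closure_image (OnePoint.continuous_coe (X := ℂ))
        (mem_image_of_mem _ (hx r hr))
      rwa [image_image] at h
    exact OnePoint.coe_injective hmem
  have h0 : (0 : ℂ) = l := by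
    refine key 0 fun r hr => Metric.mem_closure_iff.2 fun ε hε => ?_
    obtain ⟨z, hz, hzε⟩ := hsmall r hr ε hε
    exact ⟨f z, mem_image_of_mem _ hz, by rwa [dist_zero_left]⟩
  choose s hs hsc using fun n : ℕ => hlarge (1 / ((n : ℝ) + 1)) (by positivity)
  -- Compactness of this annulus yields a nonzero cluster value besides `0`.
  have hK : IsCompact (closedBall (0 : ℂ) M ∩ {x : ℂ | c ≤ ‖x‖}) :=
    (isCompact_closedBall 0 M).inter_right (isClosed_le continuous_const continuous_norm)
  obtain ⟨x, hxK, φ, hφ, hlim⟩ := hK.tendsto_subseq (x := fun n => f (s n)) fun n =>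
    ⟨by simpa using hM _ (hs n).1, hsc n⟩
  have hxl : x = l := by
    refine key x fun r hr => mem_closure_of_tendsto hlim ?_
    have h1 : Tendsto (fun n => 1 / (((φ n : ℕ) : ℝ) + 1)) atTop (𝓝 0) :=
      tendsto_one_div_add_atTop_nhds_zero_nat.comp hφ.tendsto_atTop
    filter_upwards [h1.eventually (gt_mem_nhds hr)] with n hn
    exact mem_image_of_mem _ ⟨(hs (φ n)).1, ball_subset_ball hn.le (hs (φ n)).2⟩
  have : c ≤ ‖x‖ := hxK.2
  rw [hxl, ← h0, norm_zero] at this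
  linarith

/-! ### Choice of the frequencies -/

/-- The boundary points `w` whose region comes within `ρ / N` of an `N`-th root of unity near
`w`. -/
def hitSet (lam : Circle → Set ℂ) (ρ : ℝ) (N : ℕ) : Set Circle :=
  {w | ∃ k : ℤ, ‖(w : ℂ) - Circle.exp (2 * Real.pi * k / N)‖ < 20 / N ∧
    (ball (Circle.exp (2 * Real.pi * k / N) : ℂ) (ρ / N) ∩ unitDisc ∩ lam w).Nonempty}

theorem nullMeasurableSet_hitSet {lam : Circle → Set ℂ} (h : IsRegularFamily lam) (ρ : ℝ)
    (N : ℕ) : NullMeasurableSet (hitSet lam ρ N) arcLength := by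
  have e : hitSet lam ρ N = ⋃ k : ℤ, {w : Circle |
      ‖(w : ℂ) - Circle.exp (2 * Real.pi * k / N)‖ < 20 / N} ∩ {w : Circle |
      (ball (Circle.exp (2 * Real.pi * k / N) : ℂ) (ρ / N) ∩ unitDisc ∩ lam w).Nonempty} := by
    ext w; simp [hitSet]
  rw [e]
  refine NullMeasurableSet.iUnion fun k => NullMeasurableSet.inter ?_ ?_
  · exact (isOpen_lt (by fun_prop) continuous_const).measurableSet.nullMeasurableSet
  · exact h _ inter_subset_right (isOpen_ball.inter isOpen_ball)

/-- Every `w` lies in `hitSet lam ρ N` for all large `N`, so the tail unions of complements decrease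
to `∅` and their measures tend to `0`. -/
theorem exists_arcLength_compl_hitSet_le {lam : Circle → Set ℂ}
    (h_tangential : ∀ w : Circle, EndsTangentially w (lam w))
    (h_projective : ∀ w : Circle, ProjectivelyAdjacent w (lam w))
    (h_regular : IsRegularFamily lam) {ρ : ℝ} (hρ : 0 < ρ) {ε : ENNReal} (hε : 0 < ε) (m : ℕ) :
    ∃ N, m ≤ N ∧ arcLength (hitSet lam ρ N)ᶜ ≤ ε := by
  set C : ℕ → Set Circle := fun n => ⋃ j : ℕ, (hitSet lam ρ (n + j))ᶜ with hC
  have hanti : Antitone C := by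
    intro a b hab x hx
    obtain ⟨j, hj⟩ := mem_iUnion.1 hx
    refine mem_iUnion.2 ⟨b - a + j, ?_⟩
    rwa [show a + (b - a + j) = b + j by omega]
  have hempty : ⋂ n, C n = ∅ := by
    refine eq_empty_of_forall_notMem fun w hw => ?_
    obtain ⟨n, hn⟩ := eventually_atTop.1
      (exists_near_rootOfUnity (h_tangential w) (h_projective w) hρ)
    obtain ⟨j, hj⟩ := mem_iUnion.1 (mem_iInter.1 hw n)
    exact hj (hn (n + j) (by omega))
  have ht := tendsto_measure_iInter_atTop (μ := arcLength) (s := C)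
    (fun n => NullMeasurableSet.iUnion fun j => (nullMeasurableSet_hitSet h_regular ρ _).compl)
    hanti ⟨0, measure_ne_top _ _⟩
  rw [hempty, measure_empty] at ht
  obtain ⟨N, hN, hm⟩ := ((ht.eventually (gt_mem_nhds hε)).and (eventually_ge_atTop m)).exists
  exact ⟨N, hm, (measure_mono (subset_iUnion (fun j : ℕ => (hitSet lam ρ (N + j))ᶜ) 0)).trans hN.le⟩

theorem exists_norm_peakInv_lt {lam : Circle → Set ℂ} {N : ℕ → ℕ} (hN : ∀ n, n + 1 ≤ N n)
    {w : Circle} (hw : ∀ᶠ n in atTop, w ∈ hitSet lam ((1 / 8) ^ n) (N n)) {r ε : ℝ} (hr : 0 < r)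
    (hε : 0 < ε) : ∃ z ∈ tailAt (lam w) w r, ‖peakInv N z‖ < ε := by
  have hN0 : ∀ n, 0 < N n := fun n => by have := hN n; omega
  -- `21 = 20 + 1`: distance from `w` to the root plus distance from the root to `z`, in units of `1
  -- / N n`.
  obtain ⟨n₁, hn₁⟩ := exists_nat_gt (21 / r)
  have h2 : ∀ᶠ n : ℕ in atTop, 4 / ε < 2 ^ n :=
    (tendsto_pow_atTop_atTop_of_one_lt (by norm_num : (1 : ℝ) < 2)).eventually_gt_atTop _
  obtain ⟨n, ⟨hn, hnε⟩, hnn⟩ := ((hw.and h2).and (eventually_ge_atTop n₁)).exists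
  obtain ⟨k, hk, z, ⟨hzb, hzD⟩, hzR⟩ := hn
  have hNpos : (0 : ℝ) < N n := by exact_mod_cast hN0 n
  set ζ : Circle := Circle.exp (2 * Real.pi * k / N n) with hζ
  have hz1 : ‖z‖ < 1 := by simpa [unitDisc] using hzD
  have hzζ : ‖z - ζ‖ < (1 / 8) ^ n / N n := by simpa [dist_eq_norm] using hzb
  have hζN : (ζ : ℂ) ^ N n = 1 := by
    rw [hζ, Circle.coe_exp, ← Complex.exp_nat_mul, Complex.exp_eq_one_iff]
    refine ⟨k, ?_⟩
    have : (N n : ℂ) ≠ 0 := by exact_mod_cast (hN0 n).ne'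
    push_cast
    field_simp
  refine ⟨z, ⟨hzR, ?_⟩, ?_⟩
  · have h8 : (1 / 8 : ℝ) ^ n / N n ≤ 1 / N n := by
      gcongr
      exact pow_le_one₀ (by norm_num) (by norm_num)
    have h3 : ‖z - w‖ ≤ ‖z - ζ‖ + ‖(w : ℂ) - ζ‖ := by
      have e : z - w = (z - ζ) - (w - ζ) := by ring
      rw [e]; exact norm_sub_le _ _
    have h4 : (n₁ : ℝ) < N n := by exact_mod_cast (by have := hN n; omega : n₁ < N n)
    have h5 : 21 / (N n : ℝ) < r := by
      rw [div_lt_iff₀ hNpos]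
      have := (div_lt_iff₀ hr).1 (hn₁.trans h4)
      linarith
    have h6 : 21 / (N n : ℝ) = 1 / N n + 20 / N n := by ring
    rw [mem_ball, dist_eq_norm]
    linarith
  · have h3 := le_re_peakTerm hN0 hz1 (Circle.norm_coe ζ) hζN hzζ.le
    have h4 := re_peakTerm_le_re_peakSum hN0 hz1 n
    have h5 : 2 ^ n / 4 ≤ ‖1 + peakSum N z‖ := by
      refine le_trans ?_ (Complex.re_le_norm _)
      rw [Complex.add_re, Complex.one_re]
      linarith
    rw [peakInv, norm_inv]
    refine inv_lt_of_inv_lt₀ hε (lt_of_lt_of_le ?_ h5)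
    rw [lt_div_iff₀ (by norm_num)]
    rwa [div_eq_mul_inv, mul_comm] at hnε

theorem le_norm_peakInv_of_mem_cone {N : ℕ → ℕ} (hN : ∀ n, 0 < N n) {z : ℂ} (hz : ‖z‖ < 1)
    {u : ℂ} {b : ℝ} (hb : 0 ≤ b) (hu : ‖u‖ = 1) (hc : ‖u - z‖ ≤ (1 + b) * (1 - ‖z‖)) {k : ℕ}
    (hk : ∀ n, k ≤ n → (1 / 2) ^ n ≤ ‖1 - u ^ N n‖) :
    (1 + (4 ^ k + (4 + 2 * b)) * 2)⁻¹ ≤ ‖peakInv N z‖ := by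
  have h1 := norm_peakSum_le_of_mem_cone hN hz hb hu hc hk
  have h2 : ‖1 + peakSum N z‖ ≤ 1 + ‖peakSum N z‖ := by
    simpa using norm_add_le 1 (peakSum N z)
  have h3 := (one_le_re_one_add_peakSum hN hz).trans (Complex.re_le_norm _)
  rw [peakInv, norm_inv]
  exact inv_anti₀ (by linarith) (by linarith)

theorem theorem1 (lam : Circle → Set ℂ)
    (h_tangential : ∀ w : Circle, EndsTangentially w (lam w))
    (h_projective : ∀ w : Circle, ProjectivelyAdjacent w (lam w))
    (h_regular : IsRegularFamily lam) :
    ∃ h : ℂ → ℂ, IsBoundedHolomorphic h ∧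
      ∀ᵐ w ∂arcLength, ¬ ∃ l : ℂ, IsLimitingValue h (lam w) w l := by
  choose N hN hNμ using fun n : ℕ => exists_arcLength_compl_hitSet_le h_tangential h_projective
    h_regular (ρ := (1 / 8) ^ n) (by positivity) (ε := ENNReal.ofReal ((1 / 2) ^ n))
    (ENNReal.ofReal_pos.2 (by positivity)) (n + 1)
  have hN0 : ∀ n, 0 < N n := fun n => by have := hN n; omega
  have hsum : ∀ c : ℝ, ∑' n : ℕ, ENNReal.ofReal (c * (1 / 2) ^ n) ≠ ⊤ := fun c =>
    (summable_geometric_two.mul_left c).tsum_ofReal_ne_top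
  have hhit : ∀ᵐ w ∂arcLength, ∀ᶠ n in atTop, w ∉ (hitSet lam ((1 / 8) ^ n) (N n))ᶜ :=
    ae_eventually_notMem (ne_top_of_le_ne_top (hsum 1)
      (ENNReal.tsum_le_tsum fun n => by simpa using hNμ n))
  have hgood : ∀ᵐ u ∂arcLength, ∀ᶠ n in atTop,
      u ∉ {u : Circle | ‖(1 : ℂ) - (u : ℂ) ^ N n‖ < (1 / 2) ^ n} :=
    ae_eventually_notMem (ne_top_of_le_ne_top (hsum 12)
      (ENNReal.tsum_le_tsum fun n => arcLength_setOf_norm_one_sub_pow_lt (hN0 n) (by positivity)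
        (pow_le_one₀ (by norm_num) (by norm_num))))
  have harc := ae_all_iff.2 fun k : ℕ =>
    ae_arc_inter_nonempty {u : Circle | ∀ n, k ≤ n → (1 / 2) ^ n ≤ ‖(1 : ℂ) - (u : ℂ) ^ N n‖}
  refine ⟨peakInv N, isBoundedHolomorphic_peakInv hN0, ?_⟩
  filter_upwards [hhit, hgood, harc] with w hw1 hw2 hw3
  obtain ⟨k, hk⟩ := eventually_atTop.1 hw2
  obtain ⟨hR, b, hb⟩ := h_projective w
  have hlt : ∀ z ∈ lam w, ‖z‖ < 1 := fun z hz => by simpa [unitDisc] using hR.1 hz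
  refine not_isLimitingValue (M := 1) (c := (1 + (4 ^ k + (4 + 2 * (b : ℝ))) * 2)⁻¹)
    (by positivity) (fun z hz => norm_peakInv_le_one hN0 (hlt z hz))
    (fun r hr ε hε => exists_norm_peakInv_lt hN
      (hw1.mono fun n hn => not_not.1 hn) hr hε) fun r hr => ?_
  obtain ⟨J, hJ, hJz⟩ := hb r hr
  -- `u` varies with `r`, but `k` and `b` do not, so the lower bound is the same at every scale.
  obtain ⟨u, huF, huJ⟩ := hw3 k (fun n hn => not_lt.1 (hk n hn)) J hJ
  obtain ⟨z, hz, hzu⟩ := hJz u huJ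
  exact ⟨z, hz, le_norm_peakInv_of_mem_cone hN0 (hlt z hz.1) (Nat.cast_nonneg b)
    (Circle.norm_coe u) hzu.le huF⟩
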